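/- Let $P$ be a finite poset with cover graph $G$. Write $\mathrm{Inc}(A,B)$ for the set of ordered pairs $(a,b)$ of incomparable elements with $a\in A$ and $b\in B$. Let $I\subseteq \mathrm{Inc}(\mathrm{Min}(P),\mathrm{Max}(P))$ be non-empty and doubly exposed by $(x_0,y_0)$. This means that $x_0<y_0$ in $P$, that $x_0<b$ and $a<y_0$ in $P$ for every $(a,b)\in I$, and that $G$ has a plane drawing with $x_0$ and $y_0$ on the same face. Let $A_I$ and $B_I$ be the sets of first and of second coordinates of the pairs in $I$. Fix a plane drawing of $G$ with $x_0$ and $y_0$ on the exterior face, and a corner of the exterior face at $y_0$. Fix also a tree $S\subseteq G$ with root $y_0$ that contains $A_I$, whose leaves (the root not counted) are exactly the elements of $A_I$, and in which for every $a\in A_I$ each vertex of the path from $a$ to $y_0$ is covered in $P$ by the next one. Let $<_S$ be the clockwise linear order on $A_I$ that $S$ determines when $S$ is entered at $y_0$ through the chosen corner of the exterior face. That is, if $v$ is the last common vertex of the paths in $S$ from $y_0$ to $a$ and to $a'$, then $a<_S a'$ when, going clockwise around $v$ from the edge through which $v$ was reached (from the chosen corner if $v=y_0$), one meets the edge towards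 $a$ before the edge towards $a'$. Let $H_I$ be the digraph with vertex set $\mathrm{Inc}(A_I,B_I)$ that has an edge from $(a,b)$ to $(a',b')$ when $a\le b'$ and $a'\le b$ in $P$ (the two pairs form an alternating cycle) and $a<_S a'$. Let $n\ge 2$ and let $((a_1,b_1),\dots,(a_n,b_n))$ be a directed path in $H_I$. Then $((a_i,b_i),(a_j,b_j))$ is an edge of $H_I$ for all $1\le i<j\le n$. In particular, these pairs form a copy of the standard example $S_n$: the elements $a_1,\dots,a_n,b_1,\dots,b_n$ are distinct, and the only strict relations of $P$ among them are $a_i<b_j$ for $i\ne j$. -/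

import Mathlib

/-! ## Incomparable pairs, doubly constrained sets, alternating cycles -/

/-- `Inc(A, B)`: the ordered pairs `(a, b)` of incomparable elements with `a ∈ A`, `b ∈ B`. -/
def Inc {P : Type*} [PartialOrder P] (A B : Set P) : Set (P × P) :=
  {p | p.1 ∈ A ∧ p.2 ∈ B ∧ IncompRel (· ≤ ·) p.1 p.2}

/-- `Inc(Min(P), Max(P))`. -/
def IncMinMax (P : Type*) [PartialOrder P] : Set (P × P) :=
  Inc {x : P | IsMin x} {x : P | IsMax x}

/-- `A_I`: the first coordinates of the pairs in `I`. -/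
def firstSet {P : Type*} (I : Set (P × P)) : Set P := {a | ∃ b, (a, b) ∈ I}

/-- `B_I`: the second coordinates of the pairs in `I`. -/
def secondSet {P : Type*} (I : Set (P × P)) : Set P := {b | ∃ a, (a, b) ∈ I}

/-- The non-empty set `I ⊆ Inc(Min(P), Max(P))` is doubly constrained by `(x₀, y₀)`. -/
structure DoublyConstrainedBy {P : Type*} [PartialOrder P] (I : Set (P × P)) (x₀ y₀ : P) :
    Prop where
  nonempty : I.Nonempty
  subset : I ⊆ IncMinMax P
  lt : x₀ < y₀
  lt_snd : ∀ p ∈ I, x₀ < p.2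
  fst_lt : ∀ p ∈ I, p.1 < y₀

/-- An alternating cycle of size `k ≥ 2`: incomparable pairs `(x_i, y_i)` with
`x_i ≤ y_{i+1}` for all `i`, cyclically. -/
def IsAlternatingCycle {P : Type*} [PartialOrder P] {k : ℕ} (c : Fin k → P × P) : Prop :=
  2 ≤ k ∧ (∀ i, IncompRel (· ≤ ·) (c i).1 (c i).2) ∧ ∀ i, (c i).1 ≤ (c (finRotate k i)).2

/-! ## Plane drawings

A drawing of a finite graph in the plane (equivalently, on the sphere) is given by its rotation
system: the clockwise cyclic order of the edge ends around every vertex.  A *dart* is an edge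
with a direction, and stands for the end of that edge at its tail `d.fst`.  The rotation system
is that of a drawing without crossings exactly when Euler's formula holds. -/

/-- `faceStep rot` walks along a dart and continues with the dart that comes next, clockwise,
after the reversed dart.  It thus follows the boundary of the face on the left-hand side of a
dart. -/
def faceStep {V : Type*} {G : SimpleGraph V} (rot : Equiv.Perm G.Dart) : Equiv.Perm G.Dart :=
  (SimpleGraph.Dart.symm_involutive (G := G)).toPerm.trans rot

/-- A plane drawing of the finite graph `G`, as a rotation system of genus zero. -/
structure PlaneDrawing {V : Type*} (G : SimpleGraph V) where
  /-- the next dart, clockwise, around the same vertex -/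
  rot : Equiv.Perm G.Dart
  rot_fst : ∀ d, (rot d).fst = d.fst
  rot_sameCycle : ∀ d e : G.Dart, d.fst = e.fst → rot.SameCycle d e
  /-- Euler's formula, `V + F = E + 2C` with `C` the number of components, where the faces are
  counted component by component: every component with an edge contributes the orbits of
  `faceStep` on its darts, and every isolated vertex contributes one face. -/
  euler : Nat.card V +
      (Nat.card (Quotient (Equiv.Perm.SameCycle.setoid (faceStep rot))) +
        Nat.card {v : V // ∀ w, ¬ G.Adj v w}) =
    Nat.card G.edgeSet + 2 * Nat.card G.ConnectedComponent

/-- A plane drawing of `G` with `x` and `y` on the exterior face, where `x` and `y` are distinct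
vertices of the same component (as is the case when `G` is a cover graph and `x < y`).  A vertex may have several corners on that face, so the place where `x` (and
likewise `y`) is reached from outside is part of the data: it is the corner between a dart and
its clockwise successor `cornerX`, and it belongs to the face whose boundary walk contains
`cornerX`.  Any face can be taken as the exterior one. -/
structure ExteriorDrawing {V : Type*} (G : SimpleGraph V) (x y : V) extends PlaneDrawing G where
  cornerX : G.Dart
  cornerY : G.Dart
  cornerX_fst : cornerX.fst = x
  cornerY_fst : cornerY.fst = y
  sameFace : (faceStep rot).SameCycle cornerX cornerY

/-- `I` is doubly exposed by `(x₀, y₀)`: it is doubly constrained by `(x₀, y₀)` and the cover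
graph has a plane drawing with `x₀` and `y₀` on the same face. -/
def DoublyExposedBy {P : Type*} [PartialOrder P] (I : Set (P × P)) (x₀ y₀ : P) : Prop :=
  DoublyConstrainedBy I x₀ y₀ ∧ Nonempty (ExteriorDrawing (SimpleGraph.hasse P) x₀ y₀)

/-! ## The red tree and the clockwise order of its leaves -/

/-- `S` is a red tree for `y₀` and the set `A`: a subtree of the cover graph that contains `y₀`
and `A`, whose leaves (apart from possibly the root `y₀`) are the elements of `A`, and in which
the path from every `a ∈ A` to `y₀` is a witnessing path, i.e. each of its vertices is covered
by the next one. -/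
structure IsRedTree {P : Type*} [PartialOrder P] (S : (SimpleGraph.hasse P).Subgraph) (y₀ : P)
    (A : Set P) : Prop where
  isTree : S.coe.IsTree
  root_mem : y₀ ∈ S.verts
  subset : A ⊆ S.verts
  leaf_iff : ∀ v ∈ S.verts, v ≠ y₀ → ((S.neighborSet v).ncard = 1 ↔ v ∈ A)
  witnessing : ∀ a ∈ A, ∀ p : (SimpleGraph.hasse P).Walk a y₀, p.IsPath → p.toSubgraph ≤ S →
    p.support.IsChain (· ⋖ ·)

/-- Going clockwise around a vertex from the dart `ref` (included), `d` is met before `e`. -/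
def PlaneDrawing.Precedes {V : Type*} {G : SimpleGraph V} (D : PlaneDrawing G)
    (ref d e : G.Dart) : Prop :=
  ∃ i : ℕ, (D.rot ^ i) ref = d ∧ ∀ k ≤ i, (D.rot ^ k) ref ≠ e

/-- The clockwise order on the leaves of a tree `S` with root `r`.  The paths in `S` from `r` to
`v` and to `w` share an initial segment, with list of darts `l`, and then leave their last common
vertex through darts `d` and `e`; `v` comes before `w` if `d` is met before `e` when going
clockwise around that vertex, starting from the edge through which the vertex was reached or,
if it is the root, from the corner of the exterior face that precedes the dart `c`. -/
def PlaneDrawing.ClockwiseLT {V : Type*} {G : SimpleGraph V} (D : PlaneDrawing G)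
    (S : G.Subgraph) (r : V) (c : G.Dart) (v w : V) : Prop :=
  ∃ (p : G.Walk r v) (q : G.Walk r w),
    p.IsPath ∧ q.IsPath ∧ p.toSubgraph ≤ S ∧ q.toSubgraph ≤ S ∧
    ∃ (l s t : List G.Dart) (d e : G.Dart),
      p.darts = l ++ d :: s ∧ q.darts = l ++ e :: t ∧
      D.Precedes (l.getLast?.elim c SimpleGraph.Dart.symm) d e

/-! ## The auxiliary digraph and standard examples -/

/-- The digraph `H_I` on `Inc(A_I, B_I)`: there is an edge from `(a, b)` to `(a', b')` when the
two pairs form an alternating cycle and `a <_S a'`. -/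
def auxDigraph {P : Type*} [PartialOrder P] (I : Set (P × P)) {x₀ y₀ : P}
    (D : ExteriorDrawing (SimpleGraph.hasse P) x₀ y₀)
    (S : (SimpleGraph.hasse P).Subgraph) : Digraph (Inc (firstSet I) (secondSet I)) where
  Adj p q := IsAlternatingCycle ![p.1, q.1] ∧
    D.toPlaneDrawing.ClockwiseLT S y₀ D.cornerY p.1.1 q.1.1

/-- A directed path with `n` vertices in a digraph. -/
def IsDirectedPath {V : Type*} (H : Digraph V) {n : ℕ} (p : Fin n → V) : Prop :=
  Function.Injective p ∧ ∀ i j : Fin n, (i : ℕ) + 1 = j → H.Adj (p i) (p j)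

/-- The ground set `{a_1, …, a_n, b_1, …, b_n}` of the standard example `S_n`. -/
inductive StandardExample (n : ℕ) : Type
  | a (i : Fin n) : StandardExample n
  | b (i : Fin n) : StandardExample n

/-- The order of the standard example: `a_i < b_j` if and only if `i ≠ j`, and there are no other
strict relations. -/
instance (n : ℕ) : PartialOrder (StandardExample n) where
  le x y := x = y ∨ ∃ i j, i ≠ j ∧ x = .a i ∧ y = .b j
  le_refl x := Or.inl rfl
  le_trans x y z := by
    rintro (rfl | ⟨i, j, hij, rfl, rfl⟩) (rfl | ⟨k, l, hkl, h, rfl⟩)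
    · exact Or.inl rfl
    · exact Or.inr ⟨k, l, hkl, h, rfl⟩
    · exact Or.inr ⟨i, j, hij, rfl, rfl⟩
    · cases h
  le_antisymm x y := by
    rintro (rfl | ⟨i, j, hij, rfl, rfl⟩) (h | ⟨k, l, hkl, h, h'⟩)
    · rfl
    · rfl
    · cases h
    · cases h

/-!
The relation of the digraph is transitive, and this gives everything else: along a directed path
any two pairs then form an alternating cycle, and incomparable pairs of minimal and maximal
elements with this property induce a standard example (`exists_standardExample_embedding`).

For transitivity (`auxDigraph_adj_trans`), let `(a₁, b₁) → (a₂, b₂) → (a₃, b₃)`.  In the down-set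
of `b₂` there is a walk `K` from `a₁` to `a₃`.  It misses the tree path from `a₂` to the root,
because that path lies in the up-set of `a₂`.  So `K` and the tree paths to `a₁` and `a₃` form a
closed curve which separates `a₂`, the middle one of the three leaves, from the exterior face.
As `b₃` lies above `a₂` and above `x₀`, the down-set of `b₃` contains a walk `L` from `a₂` to
`x₀`, and `L` has to meet the curve.  Every vertex of the curve is above `a₁` or above `a₃`, so
`a₁ ≤ b₃` or `a₃ ≤ b₃`, and the latter is false.  The same argument with `b₁` in place of `b₃`
gives `a₃ ≤ b₁`.  See `le_or_le_of_clockwise`.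

The topological step rests on a discrete Jordan curve theorem,
`PlaneDrawing.exists_labelling_of_closed_walk`.  Over `ZMod 2`, Euler's formula says that the
boundaries of faces span a space of the same dimension as the cycle space, hence all of it.  So for
every closed walk there is a labelling of the faces by `ZMod 2` that changes exactly across the
edges used an odd number of times.  The change of such a labelling along another walk is computed
dart by dart (`PlaneDrawing.turn`), is additive in the chain of edges that is crossed, and for a
tree path `p` and a tree path `q` it equals `1` or `0` according to whether `p` leaves `q` on the
left or on the right (`PlaneDrawing.turn_of_branch`).  For the closed curve above and the tree path
to `a₂`, the total is `1 + 0`, so `a₂` and the exterior face have different labels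
(`ExteriorDrawing.exists_mem_support_of_between`).
-/

/-! ### The cycle space and the face boundaries -/

open scoped Classical in
/-- The vertex-edge incidence matrix of `G` over `ZMod 2`; the entry at `(v, e)` counts the darts
on `e` with tail `v`. -/
noncomputable def dartIncMatrix {V : Type*} [Fintype V] (G : SimpleGraph V) :
    Matrix V G.edgeSet (ZMod 2) :=
  fun v e => ∑ d : G.Dart, if d.fst = v ∧ d.edge = e then 1 else 0

section
variable {V : Type*} {G : SimpleGraph V}

open scoped Classical in
theorem dartIncMatrix_mulVec [Fintype V] (z : G.edgeSet → ZMod 2) (v : V) :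
    (dartIncMatrix G).mulVec z v =
      ∑ d : G.Dart, if d.fst = v then z ⟨d.edge, d.edge_mem⟩ else 0 := by
  simp only [Matrix.mulVec, dotProduct, dartIncMatrix, Finset.sum_mul]
  rw [Finset.sum_comm]
  refine Finset.sum_congr rfl fun d _ => ?_
  rw [Finset.sum_eq_single ⟨d.edge, d.edge_mem⟩]
  · simp
  · rintro ⟨e, he⟩ - hne
    have : d.edge ≠ e := fun h => hne (Subtype.ext h.symm)
    simp [this]
  · simp

open scoped Classical in
theorem sum_dart_edge_eq [Fintype V] (d : G.Dart) (h : G.Dart → ZMod 2) :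
    (∑ x : G.Dart, if x.edge = d.edge then h x else 0) = h d + h d.symm := by
  have h1 : (Finset.univ.filter fun x : G.Dart => x.edge = d.edge) = {d, d.symm} := by
    ext x
    simp [SimpleGraph.dart_edge_eq_iff]
  rw [← Finset.sum_filter, h1, Finset.sum_pair d.symm_ne.symm]

open scoped Classical in
theorem dartIncMatrix_transpose_mulVec [Fintype V] (h : V → ZMod 2) (d : G.Dart) :
    (dartIncMatrix G).transpose.mulVec h ⟨d.edge, d.edge_mem⟩ = h d.fst + h d.snd := by
  rw [show h d.fst + h d.snd = h d.fst + h d.symm.fst from rfl,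
    ← sum_dart_edge_eq d fun x => h x.fst]
  simp only [Matrix.mulVec, dotProduct, dartIncMatrix, Finset.sum_mul, Matrix.transpose_apply]
  rw [Finset.sum_comm]
  refine Finset.sum_congr rfl fun x _ => ?_
  by_cases hx : x.edge = d.edge <;> simp [hx]

open scoped Classical in
/-- The cycle space of a finite graph has dimension at most `E - V + C`. -/
theorem finrank_ker_dartIncMatrix_le [Fintype V] :
    Module.finrank (ZMod 2) (LinearMap.ker (dartIncMatrix G).mulVecLin) + Nat.card V ≤
      Nat.card G.edgeSet + Nat.card G.ConnectedComponent := by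
  have h1 := (dartIncMatrix G).mulVecLin.finrank_range_add_finrank_ker
  have h2 := (dartIncMatrix G).transpose.mulVecLin.finrank_range_add_finrank_ker
  have h3 := (dartIncMatrix G).rank_transpose
  simp only [Matrix.rank] at h3
  have h4 : Module.finrank (ZMod 2) (LinearMap.ker (dartIncMatrix G).transpose.mulVecLin) ≤
      Nat.card G.ConnectedComponent := by
    let φ : LinearMap.ker (dartIncMatrix G).transpose.mulVecLin →ₗ[ZMod 2]
        (G.ConnectedComponent → ZMod 2) :=
      { toFun := fun h c => h.1 c.out
        map_add' := fun _ _ => rfl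
        map_smul' := fun _ _ => rfl }
    have hφ : Function.Injective φ := by
      rw [injective_iff_map_eq_zero]
      rintro ⟨h, hh⟩ h0
      have hadj : ∀ u v, G.Adj u v → h u = h v := by
        intro u v huv
        have := dartIncMatrix_transpose_mulVec h ⟨(u, v), huv⟩
        rw [← Matrix.mulVecLin_apply, LinearMap.mem_ker.1 hh] at this
        exact CharTwo.add_eq_zero.1 this.symm
      have hreach : ∀ u v, G.Reachable u v → h u = h v := by
        rintro u v ⟨w⟩
        induction w with
        | nil => rfl
        | cons hv _ ih => exact (hadj _ _ hv).trans ih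
      ext v
      have h1 := congrFun h0 (G.connectedComponentMk v)
      have h2 : G.Reachable (G.connectedComponentMk v).out v :=
        SimpleGraph.ConnectedComponent.exact (Quot.out_eq _)
      exact (hreach _ _ h2).symm.trans h1
    have := LinearMap.finrank_le_finrank_of_injective hφ
    simpa [Module.finrank_fintype_fun_eq_card, Nat.card_eq_fintype_card] using this
  simp only [Module.finrank_fintype_fun_eq_card, ← Nat.card_eq_fintype_card] at h1 h2
  omega

theorem faceStep_symm (rot : Equiv.Perm G.Dart) (d : G.Dart) :
    faceStep rot d.symm = rot d := by
  simp [faceStep]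

namespace PlaneDrawing

/-- The faces of a drawing, as the orbits of `faceStep`; isolated vertices contribute none. -/
abbrev Face (D : PlaneDrawing G) : Type _ :=
  Quotient (Equiv.Perm.SameCycle.setoid (faceStep D.rot))

/-- The face on the left-hand side of a dart. -/
def face (D : PlaneDrawing G) (d : G.Dart) : D.Face :=
  Quotient.mk (Equiv.Perm.SameCycle.setoid (faceStep D.rot)) d

theorem face_eq_iff (D : PlaneDrawing G) {d e : G.Dart} :
    D.face d = D.face e ↔ (faceStep D.rot).SameCycle d e :=
  Quotient.eq (r := Equiv.Perm.SameCycle.setoid (faceStep D.rot))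

theorem face_rot (D : PlaneDrawing G) (d : G.Dart) : D.face (D.rot d) = D.face d.symm := by
  rw [← faceStep_symm, face_eq_iff]
  exact (Equiv.Perm.sameCycle_apply_left).2 (Equiv.Perm.SameCycle.refl _ _)

theorem exists_dart_edge_eq (e : G.edgeSet) : ∃ d : G.Dart, d.edge = e.1 := by
  obtain ⟨e, he⟩ := e
  induction e using Sym2.ind with
  | _ u v => exact ⟨⟨(u, v), he⟩, rfl⟩

/-- The sum modulo two of the boundaries of a set of faces: the coefficient of an edge is the
sum of the labels of the faces on its two sides. -/
noncomputable def faceBoundary (D : PlaneDrawing G) :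
    (D.Face → ZMod 2) →ₗ[ZMod 2] (G.edgeSet → ZMod 2) where
  toFun f e := f (D.face (exists_dart_edge_eq e).choose) +
    f (D.face (exists_dart_edge_eq e).choose.symm)
  map_add' f g := by
    ext e
    simp only [Pi.add_apply]
    ring
  map_smul' c f := by
    ext e
    simp only [Pi.smul_apply, smul_eq_mul, RingHom.id_apply]
    ring

theorem faceBoundary_apply (D : PlaneDrawing G) (f : D.Face → ZMod 2) (d : G.Dart) :
    D.faceBoundary f ⟨d.edge, d.edge_mem⟩ = f (D.face d) + f (D.face d.symm) := by
  have h := (exists_dart_edge_eq ⟨d.edge, d.edge_mem⟩).choose_spec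
  simp only [faceBoundary, LinearMap.coe_mk, AddHom.coe_mk]
  rcases (SimpleGraph.dart_edge_eq_iff _ _).1 h with h | h
  · rw [h]
  · rw [h, SimpleGraph.Dart.symm_symm, add_comm]

open scoped Classical in
theorem faceBoundary_mem_ker [Fintype V] (D : PlaneDrawing G) (f : D.Face → ZMod 2) :
    D.faceBoundary f ∈ LinearMap.ker (dartIncMatrix G).mulVecLin := by
  rw [LinearMap.mem_ker]
  ext v
  rw [Matrix.mulVecLin_apply, dartIncMatrix_mulVec]
  simp only [faceBoundary_apply, ← face_rot]
  have h1 := Equiv.sum_comp D.rot fun d : G.Dart => if d.fst = v then f (D.face d) else 0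
  simp only [D.rot_fst] at h1
  have h2 : ∀ d : G.Dart, (if d.fst = v then f (D.face d) + f (D.face (D.rot d)) else 0) =
      (if d.fst = v then f (D.face d) else 0) +
        (if d.fst = v then f (D.face (D.rot d)) else 0) := fun d => by split_ifs <;> simp
  rw [Finset.sum_congr rfl fun d _ => h2 d, Finset.sum_add_distrib, h1]
  exact CharTwo.add_self_eq_zero _

theorem eq_of_rot_invariant [Finite V] (D : PlaneDrawing G) {α : Type*} {f : G.Dart → α}
    {d e : G.Dart} (hrot : ∀ x, x.fst = d.fst → f (D.rot x) = f x) (h : d.fst = e.fst) :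
    f d = f e := by
  classical
  have := Fintype.ofFinite V
  obtain ⟨i, rfl⟩ := (D.rot_sameCycle d e h).exists_nat_pow_eq
  clear h
  have h1 : ∀ i : ℕ, ((D.rot ^ i) d).fst = d.fst ∧ f ((D.rot ^ i) d) = f d := by
    intro i
    induction i with
    | zero => exact ⟨rfl, rfl⟩
    | succ i ih =>
      rw [pow_succ', Equiv.Perm.mul_apply]
      exact ⟨(D.rot_fst _).trans ih.1, (hrot _ ih.1).trans ih.2⟩
  exact (h1 i).2.symm

theorem eq_of_reachable [Finite V] (D : PlaneDrawing G) {f : G.Dart → ZMod 2}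
    (hrot : ∀ d, f (D.rot d) = f d) (hsymm : ∀ d, f d.symm = f d) {d e : G.Dart}
    (h : G.Reachable d.fst e.fst) : f d = f e := by
  obtain ⟨w⟩ := h
  have key : ∀ {u v : V} (w : G.Walk u v) (d e : G.Dart), d.fst = u → e.fst = v → f d = f e := by
    intro u v w
    induction w with
    | nil => exact fun d e hd he => D.eq_of_rot_invariant (fun x _ => hrot x) (hd.trans he.symm)
    | @cons u v w huv _ ih =>
      intro d e hd he
      let x : G.Dart := ⟨(u, v), huv⟩
      exact (D.eq_of_rot_invariant (e := x) (fun x _ => hrot x) hd).trans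
        ((hsymm x).symm.trans (ih x.symm e rfl he))
  exact key w d e rfl rfl

/-- The kernel of the face boundary map consists of the labellings that are constant on every
component with an edge. -/
theorem finrank_ker_faceBoundary_le [Finite V] (D : PlaneDrawing G) :
    Module.finrank (ZMod 2) (LinearMap.ker D.faceBoundary) +
      Nat.card {v : V // ∀ w, ¬ G.Adj v w} ≤ Nat.card G.ConnectedComponent := by
  classical
  let N := {c : G.ConnectedComponent // ∃ d : G.Dart, G.connectedComponentMk d.fst = c}
  have h1 : Module.finrank (ZMod 2) (LinearMap.ker D.faceBoundary) ≤ Nat.card N := by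
    let φ : LinearMap.ker D.faceBoundary →ₗ[ZMod 2] (N → ZMod 2) :=
      { toFun := fun f c => f.1 (D.face c.2.choose)
        map_add' := fun _ _ => rfl
        map_smul' := fun _ _ => rfl }
    have hφ : Function.Injective φ := by
      rw [injective_iff_map_eq_zero]
      rintro ⟨f, hf⟩ h0
      have hsymm : ∀ d : G.Dart, f (D.face d.symm) = f (D.face d) := fun d => by
        have := D.faceBoundary_apply f d
        rw [LinearMap.mem_ker.1 hf] at this
        exact (CharTwo.add_eq_zero.1 this.symm).symm
      ext F
      obtain ⟨d, rfl⟩ : ∃ d, D.face d = F := Quotient.exists_rep F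
      let c : N := ⟨G.connectedComponentMk d.fst, d, rfl⟩
      have h2 : G.Reachable c.2.choose.fst d.fst :=
        SimpleGraph.ConnectedComponent.exact c.2.choose_spec
      exact (D.eq_of_reachable (f := fun d => f (D.face d)) (fun d => by rw [face_rot, hsymm])
        hsymm h2).symm.trans (congrFun h0 c)
    have := Fintype.ofFinite N
    have h2 := LinearMap.finrank_le_finrank_of_injective hφ
    rwa [Module.finrank_fintype_fun_eq_card, ← Nat.card_eq_fintype_card] at h2
  let ψ : N ⊕ {v : V // ∀ w, ¬ G.Adj v w} → G.ConnectedComponent :=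
    Sum.elim Subtype.val fun v => G.connectedComponentMk v.1
  have hiso : ∀ {u v : V}, (∀ w, ¬ G.Adj u w) → G.Reachable u v → u = v := by
    rintro u v hu ⟨w⟩
    cases w with
    | nil => rfl
    | cons h _ => exact absurd h (hu _)
  have hψ : Function.Injective ψ := by
    rintro (c | u) (c' | v) h
    · exact congrArg Sum.inl (Subtype.ext h)
    · obtain ⟨d, hd⟩ := c.2
      have := hiso v.2 (SimpleGraph.ConnectedComponent.exact (h.symm.trans hd.symm))
      exact absurd d.adj (this ▸ v.2 _)
    · obtain ⟨d, hd⟩ := c'.2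
      have := hiso u.2 (SimpleGraph.ConnectedComponent.exact (h.trans hd.symm))
      exact absurd d.adj (this ▸ u.2 _)
    · exact congrArg Sum.inr
        (Subtype.ext (hiso u.2 (SimpleGraph.ConnectedComponent.exact h)))
  have h2 := Nat.card_le_card_of_injective ψ hψ
  rw [Nat.card_sum] at h2
  omega

open scoped Classical in
/-- The discrete Jordan curve theorem: by Euler's formula the face boundaries span the whole
cycle space, so the faces on the two sides of a cycle can be told apart by a labelling that
changes exactly across the edges of the cycle. -/
theorem exists_labelling_of_mem_ker [Fintype V] (D : PlaneDrawing G) (z : G.edgeSet → ZMod 2)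
    (hz : (dartIncMatrix G).mulVec z = 0) :
    ∃ f : D.Face → ZMod 2, ∀ d : G.Dart,
      f (D.face d) + f (D.face d.symm) = z ⟨d.edge, d.edge_mem⟩ := by
  have hle : LinearMap.range D.faceBoundary ≤ LinearMap.ker (dartIncMatrix G).mulVecLin := by
    rintro _ ⟨f, rfl⟩
    exact D.faceBoundary_mem_ker f
  have h1 := finrank_ker_dartIncMatrix_le (G := G)
  have h2 := D.finrank_ker_faceBoundary_le
  have := Fintype.ofFinite D.Face
  have h3 := D.faceBoundary.finrank_range_add_finrank_ker
  rw [Module.finrank_fintype_fun_eq_card, ← Nat.card_eq_fintype_card] at h3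
  have h4 := D.euler
  have heq := Submodule.eq_of_le_of_finrank_le hle (by unfold Face at *; omega)
  have hmem : z ∈ LinearMap.ker (dartIncMatrix G).mulVecLin := hz
  rw [← heq] at hmem
  obtain ⟨f, rfl⟩ := hmem
  exact ⟨f, fun d => (D.faceBoundary_apply f d).symm⟩

end PlaneDrawing

open scoped Classical in
/-- The boundary modulo two of a walk consists of its two ends. -/
theorem sum_count_edges [Fintype V] {u v : V} (w : G.Walk u v) (x : V) :
    (∑ d : G.Dart, if d.fst = x then (w.edges.count d.edge : ZMod 2) else 0) =
      (if u = x then 1 else 0) + (if v = x then 1 else 0) := by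
  induction w with
  | nil => simpa using (CharTwo.add_self_eq_zero _).symm
  | @cons u v w h p ih =>
    let e : G.Dart := ⟨(u, v), h⟩
    have h1 := sum_dart_edge_eq e fun d => if d.fst = x then 1 else 0
    have h2 : ∀ d : G.Dart, (if d.fst = x then
        ((SimpleGraph.Walk.cons h p).edges.count d.edge : ZMod 2) else 0) =
        (if d.fst = x then (p.edges.count d.edge : ZMod 2) else 0) +
          if d.edge = e.edge then (if d.fst = x then 1 else 0) else 0 := by
      intro d
      have h3 : s(u, v) = e.edge := rfl
      rw [SimpleGraph.Walk.edges_cons, List.count_cons, h3]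
      by_cases h4 : d.edge = e.edge
      · by_cases h5 : d.fst = x <;> simp [h4, h5]
      · by_cases h5 : d.fst = x <;> simp [h4, h5, Ne.symm h4]
    rw [Finset.sum_congr rfl fun d _ => h2 d, Finset.sum_add_distrib, ih, h1]
    have h6 : (if v = x then 1 else 0 : ZMod 2) + (if v = x then 1 else 0) = 0 :=
      CharTwo.add_self_eq_zero _
    change _ + ((if u = x then 1 else 0) + (if v = x then 1 else 0)) = _
    linear_combination h6

open scoped Classical in
/-- A closed walk separates the plane: the faces can be labelled such that the label changes,
clockwise around any vertex, exactly across the edges used an odd number of times. -/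
theorem PlaneDrawing.exists_labelling_of_closed_walk [Finite V] (D : PlaneDrawing G) {u : V}
    (w : G.Walk u u) :
    ∃ f : G.Dart → ZMod 2, (∀ d e, (faceStep D.rot).SameCycle d e → f d = f e) ∧
      (∀ d, f d.symm = f d + w.edges.count d.edge) ∧
      ∀ d, f (D.rot d) = f d + w.edges.count d.edge := by
  have := Fintype.ofFinite V
  obtain ⟨f, hf⟩ := D.exists_labelling_of_mem_ker (fun e => (w.edges.count e.1 : ZMod 2)) (by
    ext x
    rw [dartIncMatrix_mulVec]
    exact (sum_count_edges w x).trans (CharTwo.add_self_eq_zero _))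
  have hs : ∀ d : G.Dart, f (D.face d.symm) = f (D.face d) + w.edges.count d.edge := by
    intro d
    have h2 := CharTwo.add_self_eq_zero (f (D.face d))
    linear_combination hf d - h2
  exact ⟨fun d => f (D.face d), fun d e h => congrArg f (D.face_eq_iff.2 h), hs,
    fun d => (congrArg f (D.face_rot d)).trans (hs d)⟩
end

/-! ### The change of a labelling along a walk -/

section
variable {V : Type*} {G : SimpleGraph V}

namespace PlaneDrawing

/-- The least number of clockwise steps that lead from the dart `ref` to the dart `d`. -/
noncomputable def steps (D : PlaneDrawing G) (ref d : G.Dart) : ℕ :=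
  sInf {i | (D.rot ^ i) ref = d}

/-- The total weight `z` of the darts met going clockwise from `ref` (included) to `d`
(excluded). -/
noncomputable def sweep (D : PlaneDrawing G) (z : G.Dart → ZMod 2) (ref d : G.Dart) : ZMod 2 :=
  ∑ k ∈ Finset.range (D.steps ref d), z ((D.rot ^ k) ref)

/-- The change of a labelling with jumps `z` along a list of darts, from the dart `ref` to the
reverse of the last dart of the list: at each vertex, the darts from the one of arrival (included)
to the one of departure are swept clockwise, and then the departing dart itself is crossed. -/
noncomputable def turn (D : PlaneDrawing G) (z : G.Dart → ZMod 2) : G.Dart → List G.Dart → ZMod 2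
  | _, [] => 0
  | ref, d :: l => D.sweep z ref d + z d + D.turn z d.symm l

theorem rot_pow_fst (D : PlaneDrawing G) (i : ℕ) (d : G.Dart) : ((D.rot ^ i) d).fst = d.fst := by
  induction i with
  | zero => rfl
  | succ i ih => rw [pow_succ', Equiv.Perm.mul_apply, D.rot_fst, ih]

theorem rot_pow_steps [Finite V] (D : PlaneDrawing G) {ref d : G.Dart} (h : ref.fst = d.fst) :
    (D.rot ^ D.steps ref d) ref = d := by
  classical
  have := Fintype.ofFinite V
  exact Nat.sInf_mem (s := {i | (D.rot ^ i) ref = d}) (D.rot_sameCycle ref d h).exists_nat_pow_eq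

theorem rot_pow_ne_of_lt_steps (D : PlaneDrawing G) {ref d : G.Dart} {k : ℕ}
    (h : k < D.steps ref d) : (D.rot ^ k) ref ≠ d :=
  Nat.notMem_of_lt_sInf (s := {i | (D.rot ^ i) ref = d}) h

theorem precedes_iff [Finite V] (D : PlaneDrawing G) {ref d e : G.Dart} (h : ref.fst = e.fst) :
    D.Precedes ref d e ↔ ∃ k < D.steps ref e, (D.rot ^ k) ref = d := by
  constructor
  · rintro ⟨i, hi, hne⟩
    exact ⟨i, not_le.1 fun hle => hne _ hle (D.rot_pow_steps h), hi⟩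
  · rintro ⟨i, hi, hd⟩
    exact ⟨i, hd, fun k hk => D.rot_pow_ne_of_lt_steps (hk.trans_lt hi)⟩

theorem Precedes.ne {D : PlaneDrawing G} {ref d e : G.Dart} (h : D.Precedes ref d e) : d ≠ e := by
  obtain ⟨i, rfl, hi⟩ := h
  exact hi i le_rfl

theorem Precedes.not_swap {D : PlaneDrawing G} {ref d e : G.Dart} (h : D.Precedes ref d e) :
    ¬ D.Precedes ref e d := by
  rintro ⟨j, hj, hj'⟩
  obtain ⟨i, hi, hi'⟩ := h
  rcases le_total i j with hij | hij
  · exact hj' i hij hi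
  · exact hi' j hij hj

theorem Precedes.trans {D : PlaneDrawing G} {ref d e g : G.Dart} (h : D.Precedes ref d e)
    (h' : D.Precedes ref e g) : D.Precedes ref d g := by
  obtain ⟨i, hi, hi'⟩ := h
  obtain ⟨j, hj, hj'⟩ := h'
  refine ⟨i, hi, fun k hk => hj' k (hk.trans ?_)⟩
  exact le_of_lt (not_le.1 fun hle => hi' j hle hj)

theorem sweep_congr (D : PlaneDrawing G) {z z' : G.Dart → ZMod 2} {ref : G.Dart} (d : G.Dart)
    (h : ∀ x, x.fst = ref.fst → z x = z' x) : D.sweep z ref d = D.sweep z' ref d :=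
  Finset.sum_congr rfl fun _ _ => h _ (D.rot_pow_fst _ _)

open scoped Classical in
theorem sweep_single [Finite V] (D : PlaneDrawing G) {ref e : G.Dart} (d : G.Dart)
    (h : ref.fst = e.fst) :
    D.sweep (fun x => if x = d then 1 else 0) ref e = if D.Precedes ref d e then 1 else 0 := by
  unfold sweep
  split_ifs with hd
  · rw [D.precedes_iff h] at hd
    obtain ⟨k, hk, hkd⟩ := hd
    refine (Finset.sum_eq_single k ?_ ?_).trans (if_pos hkd)
    · intro j hj hne
      refine if_neg fun hjd => ?_
      -- two visits of `d` before `e` would allow a shortcut to `e`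
      have key : ∀ m n, m < n → n < D.steps ref e → (D.rot ^ m) ref ≠ (D.rot ^ n) ref := by
        intro m n hmn hn heq
        refine D.rot_pow_ne_of_lt_steps (ref := ref) (d := e) (k := D.steps ref e - n + m)
          (by omega) ?_
        rw [pow_add, Equiv.Perm.mul_apply, heq, ← Equiv.Perm.mul_apply, ← pow_add,
          Nat.sub_add_cancel hn.le]
        exact D.rot_pow_steps h
      rcases lt_or_gt_of_ne hne with hlt | hlt
      · exact key _ _ hlt hk (hjd.trans hkd.symm)
      · exact key _ _ hlt (Finset.mem_range.1 hj) (hkd.trans hjd.symm)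
    · exact fun hk' => absurd (Finset.mem_range.2 hk) hk'
  · refine Finset.sum_eq_zero fun k hk => if_neg fun hkd => hd ?_
    exact (D.precedes_iff h).2 ⟨k, Finset.mem_range.1 hk, hkd⟩

theorem precedes_self_iff (D : PlaneDrawing G) {ref e : G.Dart} :
    D.Precedes ref ref e ↔ ref ≠ e := by
  refine ⟨fun h => h.ne, fun h => ⟨0, rfl, fun k hk => ?_⟩⟩
  obtain rfl := Nat.le_zero.1 hk
  exact h

theorem turn_add (D : PlaneDrawing G) (z z' : G.Dart → ZMod 2) (ref : G.Dart)
    (l : List G.Dart) :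
    D.turn (fun x => z x + z' x) ref l = D.turn z ref l + D.turn z' ref l := by
  induction l generalizing ref with
  | nil => simp [turn]
  | cons d l ih =>
    simp only [turn, ih, sweep, Finset.sum_add_distrib]
    ring

theorem turn_eq_zero (D : PlaneDrawing G) {z : G.Dart → ZMod 2} {u v : V} (q : G.Walk u v)
    {ref : G.Dart} (href : ref.fst = u) (h : ∀ x : G.Dart, x.fst ∈ q.support → z x = 0) :
    D.turn z ref q.darts = 0 := by
  induction q generalizing ref with
  | nil => rfl
  | cons hv q ih =>
    rw [SimpleGraph.Walk.darts_cons, turn, ih rfl fun x hx => h x (List.mem_cons_of_mem _ hx),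
      h _ List.mem_cons_self, sweep, Finset.sum_eq_zero]
    · simp
    · intro k _
      exact h _ (by rw [D.rot_pow_fst, href]; exact List.mem_cons_self)

/-- Following a labelling along a walk changes it by `turn`. -/
theorem exists_eq_add_turn [Finite V] (D : PlaneDrawing G) {f z : G.Dart → ZMod 2}
    (hs : ∀ d, f d.symm = f d + z d) (hr : ∀ d, f (D.rot d) = f d + z d) {u v : V}
    (q : G.Walk u v) {ref : G.Dart} (href : ref.fst = u) :
    ∃ x : G.Dart, x.fst = v ∧ f x = f ref + D.turn z ref q.darts := by
  induction q generalizing ref with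
  | nil => exact ⟨ref, href, by simp [turn]⟩
  | @cons u v w h q ih =>
    let d : G.Dart := ⟨(u, v), h⟩
    obtain ⟨x, hx, hfx⟩ := ih (ref := d.symm) rfl
    refine ⟨x, hx, ?_⟩
    have h1 : ∀ i : ℕ, f ((D.rot ^ i) ref) =
        f ref + ∑ k ∈ Finset.range i, z ((D.rot ^ k) ref) := by
      intro i
      induction i with
      | zero => simp
      | succ i ih =>
        rw [pow_succ', Equiv.Perm.mul_apply, hr, ih, Finset.sum_range_succ, add_assoc]
    have h2 := h1 (D.steps ref d)
    rw [D.rot_pow_steps (d := d) href] at h2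
    rw [hfx, hs, h2, SimpleGraph.Walk.darts_cons, turn, sweep]
    ring

theorem edge_mem_edges_cons_iff {u v w : V} {h : G.Adj u v} {p : G.Walk v w}
    (hp : (SimpleGraph.Walk.cons h p).IsPath) {x : G.Dart} (hx : x.fst = u) :
    x.edge ∈ (SimpleGraph.Walk.cons h p).edges ↔ x = ⟨(u, v), h⟩ := by
  have hu : u ∉ p.support := (SimpleGraph.Walk.cons_isPath_iff _ _).1 hp |>.2
  let d : G.Dart := ⟨(u, v), h⟩
  rw [SimpleGraph.Walk.edges_cons, List.mem_cons]
  constructor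
  · rintro (h1 | h1)
    · rcases (SimpleGraph.dart_edge_eq_iff x d).1 h1 with h2 | h2
      · exact h2
      · rw [h2] at hx
        exact absurd hx h.ne'
    · refine absurd (p.fst_mem_support_of_mem_edges (t := x.fst) (u := x.snd) h1) ?_
      rwa [hx]
  · rintro rfl
    exact Or.inl rfl

open scoped Classical in
theorem sweep_of_two_darts [Finite V] (D : PlaneDrawing G) {z : G.Dart → ZMod 2}
    {ref d e : G.Dart} {ε : ZMod 2} (h : ref.fst = e.fst) (hε : ε = 0 ∨ ref ≠ e)
    (hz : ∀ x : G.Dart, x.fst = ref.fst →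
      z x = (if x = d then 1 else 0) + ε * if x = ref then 1 else 0) :
    D.sweep z ref e = ε + if D.Precedes ref d e then 1 else 0 := by
  rw [D.sweep_congr e hz, ← D.sweep_single d h]
  have h1 := D.sweep_single ref h
  rw [precedes_self_iff] at h1
  simp only [sweep, Finset.sum_add_distrib, ← Finset.mul_sum] at h1 ⊢
  rw [h1, add_comm]
  rcases hε with rfl | hne
  · simp
  · simp [hne]

open scoped Classical in
/-- If the paths `p` and `q` share the darts `l` and then part, the labelling with jumps along `p`
changes along `q` if and only if `p` leaves `q` on the left.  Here `ε = 1` means that `ref` leads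
back along an earlier common edge of the two paths, which is also crossed by the labelling. -/
theorem turn_of_branch [Finite V] (D : PlaneDrawing G) {u v w : V} {p : G.Walk u v}
    {q : G.Walk u w} (hp : p.IsPath) (hq : q.IsPath) {l s t : List G.Dart} {d e : G.Dart}
    (hpd : p.darts = l ++ d :: s) (hqe : q.darts = l ++ e :: t) (hde : d ≠ e)
    (hdisj : ∀ x ∈ e :: t, x.snd ∉ p.support) {ref : G.Dart} (href : ref.fst = u) {ε : ZMod 2}
    (hε : ε = 0 ∨ ε = 1 ∧ ref.snd ∉ q.support) {z : G.Dart → ZMod 2}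
    (hz : ∀ x : G.Dart, x.fst ∈ q.support →
      z x = (if x.edge ∈ p.edges then 1 else 0) + ε * if x = ref then 1 else 0) :
    D.turn z ref q.darts =
      ε + if D.Precedes (l.getLast?.elim ref SimpleGraph.Dart.symm) d e then 1 else 0 := by
  induction l generalizing u ref ε with
  | nil =>
    cases p with
    | nil => simp at hpd
    | @cons _ a _ h1 p =>
    cases q with
    | nil => simp at hqe
    | @cons _ b _ h2 q =>
    simp only [SimpleGraph.Walk.darts_cons, List.nil_append, List.cons.injEq] at hpd hqe
    obtain ⟨rfl, rfl⟩ := hpd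
    obtain ⟨rfl, rfl⟩ := hqe
    have hε' : ε = 0 ∨ ref ≠ ⟨(u, b), h2⟩ := hε.imp_right fun h heq => h.2 (by
      rw [heq]
      exact List.mem_cons_of_mem _ q.start_mem_support)
    have hz0 : ∀ x : G.Dart, x.fst = u →
        z x = (if x = ⟨(u, a), h1⟩ then 1 else 0) + ε * if x = ref then 1 else 0 := by
      intro x hx
      rw [hz x (hx ▸ List.mem_cons_self), if_congr (edge_mem_edges_cons_iff hp hx) rfl rfl]
    have hzq : D.turn z (SimpleGraph.Dart.symm ⟨(u, b), h2⟩) q.darts = 0 := by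
      refine D.turn_eq_zero q rfl fun x hx => ?_
      have hxp : x.fst ∉ (SimpleGraph.Walk.cons h1 p).support := by
        have h3 : x.fst ∈ (SimpleGraph.Walk.cons h2 q).support.tail := hx
        rw [← SimpleGraph.Walk.map_snd_darts, List.mem_map] at h3
        obtain ⟨y, hy, hyx⟩ := h3
        exact hyx ▸ hdisj y hy
      have hxe : x.edge ∉ (SimpleGraph.Walk.cons h1 p).edges := fun h =>
        hxp (SimpleGraph.Walk.fst_mem_support_of_mem_edges _ h)
      have hxr : x ≠ ref := by
        rintro rfl
        exact hxp (href ▸ List.mem_cons_self)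
      rw [hz x (List.mem_cons_of_mem _ hx), if_neg hxe, if_neg hxr]
      simp
    change _ = ε + if D.Precedes ref _ _ then 1 else 0
    rw [SimpleGraph.Walk.darts_cons, turn, hzq,
      D.sweep_of_two_darts href hε' (fun x hx => hz0 x (hx.trans href)), hz0 _ rfl, if_neg hde.symm]
    rcases hε' with rfl | hne
    · simp
    · simp [hne.symm]
  | cons g l ih =>
    cases p with
    | nil => simp at hpd
    | @cons _ a _ h1 p =>
    cases q with
    | nil => simp at hqe
    | @cons _ b _ h2 q =>
    simp only [SimpleGraph.Walk.darts_cons, List.cons_append, List.cons.injEq] at hpd hqe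
    obtain ⟨rfl, hpd⟩ := hpd
    obtain ⟨hab, hqe⟩ := hqe
    obtain rfl : b = a := congrArg (fun x : G.Dart => x.snd) hab
    have hup := ((SimpleGraph.Walk.cons_isPath_iff _ _).1 hp).2
    have huq := ((SimpleGraph.Walk.cons_isPath_iff _ _).1 hq).2
    let g : G.Dart := ⟨(u, b), h1⟩
    have hε' : ε = 0 ∨ ref ≠ g := hε.imp_right fun h heq => h.2 (by
      rw [heq]
      exact List.mem_cons_of_mem _ q.start_mem_support)
    have hz0 : ∀ x : G.Dart, x.fst = u →
        z x = (if x = g then 1 else 0) + ε * if x = ref then 1 else 0 := by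
      intro x hx
      rw [hz x (hx ▸ List.mem_cons_self), if_congr (edge_mem_edges_cons_iff hp hx) rfl rfl]
    have hlast : (g :: l).getLast?.elim ref SimpleGraph.Dart.symm =
        l.getLast?.elim g.symm SimpleGraph.Dart.symm := by
      cases h : l.getLast? <;> simp [List.getLast?_cons, h]
    rw [SimpleGraph.Walk.darts_cons, turn,
      D.sweep_of_two_darts href hε' (fun x hx => hz0 x (hx.trans href)), hz0 _ rfl,
      ih ((SimpleGraph.Walk.cons_isPath_iff _ _).1 hp).1
        ((SimpleGraph.Walk.cons_isPath_iff _ _).1 hq).1 hpd hqe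
        (fun x hx h => hdisj x hx (List.mem_cons_of_mem _ h)) (ref := g.symm) rfl (ε := 1)
        (Or.inr ⟨rfl, huq⟩) ?_]
    · rw [show ((⟨(u, b), h1⟩ : G.Dart) :: l) = g :: l from rfl, hlast,
        if_neg (fun h : D.Precedes ref g g => h.ne rfl)]
      have h4 : (1 + 1 : ZMod 2) = 0 := CharTwo.add_self_eq_zero _
      have h5 : ε * (if g = ref then 1 else 0) = 0 := by
        rcases hε' with rfl | hne
        · simp
        · simp [hne.symm]
      rw [if_pos rfl, show (⟨(u, b), h2⟩ : G.Dart) = g from rfl, h5]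
      linear_combination h4
    · intro x hx
      have hxu : x.fst ≠ u := fun h => huq (h ▸ hx)
      have hxr : x ≠ ref := fun h => hxu (h ▸ href)
      rw [hz x (List.mem_cons_of_mem _ hx), if_neg hxr, mul_zero, add_zero, one_mul,
        SimpleGraph.Walk.edges_cons]
      have hgx : x.edge = s(u, b) ↔ x = g.symm := by
        constructor
        · intro h
          rcases (SimpleGraph.dart_edge_eq_iff x g).1 h with h | h
          · exact absurd (congrArg (fun y : G.Dart => y.fst) h) hxu
          · exact h
        · rintro rfl
          exact g.edge_symm
      by_cases h6 : x = g.symm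
      · have h7 : x.edge ∉ p.edges := fun h => hup (by
          have := p.snd_mem_support_of_mem_edges (t := x.fst) (u := x.snd) h
          rwa [h6] at this)
        rw [if_pos (List.mem_cons.2 (Or.inl (hgx.2 h6))), if_neg h7, if_pos h6, zero_add]
      · rw [if_neg h6, add_zero]
        refine if_congr ?_ rfl rfl
        rw [List.mem_cons, hgx]
        exact or_iff_right h6

end PlaneDrawing

/-! ### Paths in a tree and the clockwise order -/

theorem SimpleGraph.Walk.IsPath.eq_of_toSubgraph_le {S : G.Subgraph} (hS : S.coe.IsAcyclic)
    {u v : V} {p q : G.Walk u v} (hp : p.IsPath) (hq : q.IsPath) (hpS : p.toSubgraph ≤ S)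
    (hqS : q.toSubgraph ≤ S) : p = q := by
  have hu : u ∈ S.verts := hpS.1 p.start_mem_verts_toSubgraph
  have hv : v ∈ S.verts := hpS.1 p.end_mem_verts_toSubgraph
  have key : ∀ w : G.Walk u v, w.toSubgraph ≤ S →
      ∃ w' : S.coe.Walk ⟨u, hu⟩ ⟨v, hv⟩, w'.map S.hom = w := by
    intro w hw
    refine ⟨w.mapToSubgraph.map (SimpleGraph.Subgraph.inclusion hw), ?_⟩
    exact (SimpleGraph.Walk.map_map _ _ _).trans w.map_mapToSubgraph_hom
  obtain ⟨p', rfl⟩ := key p hpS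
  obtain ⟨q', rfl⟩ := key q hqS
  exact congrArg (SimpleGraph.Walk.map S.hom) (congrArg Subtype.val
    ((hS.subsingleton_path _ _).elim ⟨p', hp.of_map⟩ ⟨q', hq.of_map⟩))

/-- Two paths of a tree with the same origin never meet again after they part. -/
theorem SimpleGraph.Walk.IsPath.snd_notMem_support_of_branch {S : G.Subgraph}
    (hS : S.coe.IsAcyclic) {r v w : V} {p : G.Walk r v} {q : G.Walk r w} (hp : p.IsPath)
    (hq : q.IsPath) (hpS : p.toSubgraph ≤ S) (hqS : q.toSubgraph ≤ S)
    {l s t : List G.Dart} {d e : G.Dart} (hpd : p.darts = l ++ d :: s)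
    (hqe : q.darts = l ++ e :: t) (hde : d ≠ e) : ∀ x ∈ e :: t, x.snd ∉ p.support := by
  classical
  intro x hx hxp
  have hxq : x.snd ∈ q.support := by
    refine List.mem_of_mem_tail ?_
    rw [← SimpleGraph.Walk.map_snd_darts, hqe]
    exact List.mem_map_of_mem (List.mem_append_right _ hx)
  have hle : ∀ {w' : V} (q : G.Walk r w') (h : x.snd ∈ q.support), q.toSubgraph ≤ S →
      (q.takeUntil _ h).toSubgraph ≤ S := by
    intro w' q h hq
    rw [← q.take_spec h, SimpleGraph.Walk.toSubgraph_append] at hq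
    exact le_sup_left.trans hq
  -- the initial segments up to the common vertex coincide by uniqueness of paths
  have h1 : p.takeUntil _ hxp = q.takeUntil _ hxq :=
    (hp.takeUntil _).eq_of_toSubgraph_le hS (hq.takeUntil _) (hle p hxp hpS) (hle q hxq hqS)
  have h2 := congrArg SimpleGraph.Walk.darts (p.take_spec hxp)
  have h3 := congrArg SimpleGraph.Walk.darts (q.take_spec hxq)
  rw [SimpleGraph.Walk.darts_append] at h2 h3
  rw [h1, hpd] at h2
  rw [hqe] at h3
  have h4 : x ∉ (q.dropUntil _ hxq).darts := by
    intro h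
    have h5 := (hq.dropUntil hxq).support_nodup
    rw [← SimpleGraph.Walk.cons_tail_support, List.nodup_cons] at h5
    refine h5.1 ?_
    rw [← SimpleGraph.Walk.map_snd_darts]
    exact List.mem_map_of_mem h
  rcases List.append_eq_append_iff.1 h3 with ⟨m, hm, hm'⟩ | ⟨m, hm, hm'⟩
  · exact h4 (hm' ▸ List.mem_append_right _ hx)
  · cases m with
    | nil =>
      rw [List.nil_append] at hm'
      exact h4 (hm' ▸ hx)
    | cons e' m =>
      obtain ⟨rfl, -⟩ := List.cons_eq_cons.1 hm'
      rw [hm, List.append_assoc, List.append_cancel_left_eq, List.cons_append] at h2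
      exact hde (List.cons_eq_cons.1 h2).1.symm

theorem PlaneDrawing.ClockwiseLT.trans {D : PlaneDrawing G} {S : G.Subgraph}
    (hS : S.coe.IsAcyclic) {r : V} {c : G.Dart} {u v w : V} (h : D.ClockwiseLT S r c u v)
    (h' : D.ClockwiseLT S r c v w) : D.ClockwiseLT S r c u w := by
  obtain ⟨p, q, hp, hq, hpS, hqS, l, s, t, d, e, hpd, hqe, hde⟩ := h
  obtain ⟨q', p', hq', hp', hqS', hpS', l', s', t', d', e', hqd', hpe', hde'⟩ := h'
  obtain rfl := hq.eq_of_toSubgraph_le hS hq' hqS hqS'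
  refine ⟨p, p', hp, hp', hpS, hpS', ?_⟩
  rw [hqe] at hqd'
  rcases List.append_eq_append_iff.1 hqd' with ⟨m, rfl, hm'⟩ | ⟨m, rfl, hm'⟩
  · cases m with
    | nil =>
      rw [List.nil_append, List.cons_eq_cons] at hm'
      obtain ⟨rfl, -⟩ := hm'
      rw [List.append_nil] at hpe' hde'
      exact ⟨l, s, t', d, e', hpd, hpe', hde.trans hde'⟩
    | cons g m =>
      obtain ⟨rfl, -⟩ := List.cons_eq_cons.1 hm'
      exact ⟨l, s, m ++ e' :: t', d, e, hpd, by simp [hpe'], hde⟩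
  · cases m with
    | nil =>
      rw [List.nil_append, List.cons_eq_cons] at hm'
      obtain ⟨rfl, -⟩ := hm'
      rw [List.append_nil] at hpd hde
      exact ⟨l', s, t', d, e', hpd, hpe', hde.trans hde'⟩
    | cons g m =>
      obtain ⟨rfl, -⟩ := List.cons_eq_cons.1 hm'
      exact ⟨l', m ++ d :: s, t', d', e', by simp [hpd], hpe', hde'⟩

/-! ### Separation by a closed curve through the tree -/

theorem SimpleGraph.Walk.IsPath.count_edges [DecidableEq V] {u v : V} {p : G.Walk u v}
    (hp : p.IsPath) (e : Sym2 V) : p.edges.count e = if e ∈ p.edges then 1 else 0 :=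
  hp.isTrail.edges_nodup.count

/-- If the leaf `b` lies between the leaves `a` and `c` of a tree rooted at `y`, then the closed
curve made of the tree paths `p` and `r` from `y` to `a` and `c` and of a walk `K` from `a` to `c`
separates `b` from the exterior face, unless `K` meets the tree path `q` to `b`. -/
theorem ExteriorDrawing.exists_mem_support_of_between [Finite V] {x y : V}
    (D : ExteriorDrawing G x y) {S : G.Subgraph} (hS : S.coe.IsAcyclic) {a b c : V}
    (hab : D.toPlaneDrawing.ClockwiseLT S y D.cornerY a b)
    (hbc : D.toPlaneDrawing.ClockwiseLT S y D.cornerY b c) (K : G.Walk a c) (L : G.Walk b x) :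
    ∃ (p : G.Walk y a) (q : G.Walk y b) (r : G.Walk y c), p.IsPath ∧ q.IsPath ∧ r.IsPath ∧
      p.toSubgraph ≤ S ∧ q.toSubgraph ≤ S ∧ r.toSubgraph ≤ S ∧
      ((∃ u ∈ K.support, u ∈ q.support) ∨
        ∃ u ∈ L.support, u ∈ p.support ∨ u ∈ r.support ∨ u ∈ K.support) := by
  classical
  obtain ⟨p, q, hp, hq, hpS, hqS, l, s, t, d, e, hpd, hqe, hde⟩ := hab
  obtain ⟨q', r, hq', hr, hqS', hrS, l', t', s', e', d', hqe', hrd, hde'⟩ := hbc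
  obtain rfl := hq.eq_of_toSubgraph_le hS hq' hqS hqS'
  refine ⟨p, q, r, hp, hq, hr, hpS, hqS, hrS, ?_⟩
  by_contra! hcon
  obtain ⟨hKq, hL⟩ := hcon
  obtain ⟨f, hface, hsymm, hrot⟩ :=
    D.toPlaneDrawing.exists_labelling_of_closed_walk ((p.append K).append r.reverse)
  let zp : G.Dart → ZMod 2 := fun x => p.edges.count x.edge
  let zr : G.Dart → ZMod 2 := fun x => r.edges.count x.edge
  let zK : G.Dart → ZMod 2 := fun x => K.edges.count x.edge
  have hzw : ∀ x : G.Dart, ((((p.append K).append r.reverse).edges.count x.edge : ℕ) : ZMod 2) =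
      zp x + zr x + zK x := by
    intro x
    simp only [SimpleGraph.Walk.edges_append, SimpleGraph.Walk.edges_reverse, List.count_append,
      List.count_reverse, Nat.cast_add, zp, zr, zK]
    ring
  simp only [hzw] at hsymm hrot
  have hzero : ∀ {u v : V} (w : G.Walk u v) (x : G.Dart), x.fst ∉ w.support →
      (w.edges.count x.edge : ZMod 2) = 0 := by
    intro u v w x hx
    rw [List.count_eq_zero_of_not_mem, Nat.cast_zero]
    exact fun h => hx (w.fst_mem_support_of_mem_edges h)
  -- along `q` the label changes at the branching from `p`, but not at that from `r`
  have htp : D.turn zp D.cornerY q.darts = 1 := by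
    rw [D.turn_of_branch hp hq hpd hqe hde.ne
      (hp.snd_notMem_support_of_branch hS hq hpS hqS hpd hqe hde.ne) D.cornerY_fst (Or.inl rfl)
      fun x _ => ?_, if_pos hde, zero_add]
    simp only [zp, hp.count_edges]
    split_ifs <;> simp
  have htr : D.turn zr D.cornerY q.darts = 0 := by
    rw [D.turn_of_branch hr hq hrd hqe' hde'.ne.symm
      (hr.snd_notMem_support_of_branch hS hq hrS hqS hrd hqe' hde'.ne.symm) D.cornerY_fst
      (Or.inl rfl) fun x _ => ?_, if_neg hde'.not_swap, zero_add]
    simp only [zr, hr.count_edges]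
    split_ifs <;> simp
  have htK : D.turn zK D.cornerY q.darts = 0 :=
    D.turn_eq_zero q D.cornerY_fst fun x hx => hzero K x fun h => hKq _ h hx
  obtain ⟨g, hgb, hg⟩ := D.exists_eq_add_turn hsymm hrot q D.cornerY_fst
  rw [D.turn_add (fun x => zp x + zr x), D.turn_add, htp, htr, htK] at hg
  -- along `L` the label does not change at all
  obtain ⟨g', hgx, hg'⟩ := D.exists_eq_add_turn hsymm hrot L hgb
  have hzL : ∀ x : G.Dart, x.fst ∈ L.support → zp x + zr x + zK x = 0 := by
    intro x hx
    obtain ⟨h1, h2, h3⟩ := hL _ hx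
    simp only [zp, zr, zK, hzero p x h1, hzero r x h2, hzero K x h3, add_zero]
  rw [D.turn_eq_zero L hgb hzL] at hg'
  have hx : f g' = f D.cornerX := by
    refine D.eq_of_rot_invariant (fun w hw => ?_) (hgx.trans D.cornerX_fst.symm)
    rw [hrot, hzL w (by rw [hw, hgx]; exact L.end_mem_support), add_zero]
  have hxy := hface _ _ D.sameFace
  have : (1 : ZMod 2) = 0 := by linear_combination hx + hxy - hg - hg'
  exact one_ne_zero this
end

/-! ### Transitivity of the digraph and standard examples -/

section
variable {P : Type*} [PartialOrder P]

theorem exists_hasse_walk_of_le [Finite P] {a b : P} (h : a ≤ b) :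
    ∃ w : (SimpleGraph.hasse P).Walk a b, ∀ u ∈ w.support, a ≤ u ∧ u ≤ b := by
  classical
  have := Fintype.ofFinite P
  have := Fintype.toLocallyFiniteOrder (α := P)
  have h' := le_iff_reflTransGen_covBy.1 h
  induction h' using Relation.ReflTransGen.head_induction_on with
  | refl => exact ⟨.nil, by simp⟩
  | @head a c hac hcb ih =>
    obtain ⟨w, hw⟩ := ih (le_iff_reflTransGen_covBy.2 hcb)
    refine ⟨.cons (SimpleGraph.hasse_adj.2 (Or.inl hac)) w, fun u hu => ?_⟩
    rcases List.mem_cons.1 hu with rfl | hu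
    · exact ⟨le_rfl, h⟩
    · exact ⟨hac.le.trans (hw u hu).1, (hw u hu).2⟩

theorem IsRedTree.le_of_mem_support {S : (SimpleGraph.hasse P).Subgraph} {y : P} {A : Set P}
    (hS : IsRedTree S y A) {a : P} (ha : a ∈ A) {p : (SimpleGraph.hasse P).Walk y a}
    (hp : p.IsPath) (hpS : p.toSubgraph ≤ S) {u : P} (hu : u ∈ p.support) : a ≤ u := by
  have h := hS.witnessing a ha p.reverse hp.reverse (by rwa [p.toSubgraph_reverse])
  have h' : p.reverse.support.Pairwise (· < ·) :=
    (h.imp fun _ _ hc => hc.lt).pairwise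
  rw [← SimpleGraph.Walk.cons_tail_support, List.pairwise_cons] at h'
  have hu' : u ∈ p.reverse.support := by simpa using hu
  rw [← SimpleGraph.Walk.cons_tail_support, List.mem_cons] at hu'
  rcases hu' with rfl | hu'
  · exact le_rfl
  · exact (h'.1 u hu').le

/-- Let `a`, `m`, `c` be leaves in clockwise order.  If `a` and `c` lie below some `b` that is not
above `m`, then every upper bound `b'` of `m` and `x₀` is above `a` or above `c`: otherwise the
down-sets of `b` and `b'` would contain disjoint walks from `a` to `c` and from `m` to `x₀`. -/
theorem le_or_le_of_clockwise [Finite P] {x₀ y₀ : P}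
    (D : ExteriorDrawing (SimpleGraph.hasse P) x₀ y₀) {S : (SimpleGraph.hasse P).Subgraph}
    {A : Set P} (hS : IsRedTree S y₀ A) {a m c b b' : P} (ha : a ∈ A) (hm : m ∈ A) (hc : c ∈ A)
    (ham : D.toPlaneDrawing.ClockwiseLT S y₀ D.cornerY a m)
    (hmc : D.toPlaneDrawing.ClockwiseLT S y₀ D.cornerY m c)
    (hab : a ≤ b) (hcb : c ≤ b) (hmb : ¬ m ≤ b) (hmb' : m ≤ b') (hxb' : x₀ ≤ b') :
    a ≤ b' ∨ c ≤ b' := by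
  obtain ⟨w₁, hw₁⟩ := exists_hasse_walk_of_le hab
  obtain ⟨w₂, hw₂⟩ := exists_hasse_walk_of_le hcb
  obtain ⟨w₃, hw₃⟩ := exists_hasse_walk_of_le hmb'
  obtain ⟨w₄, hw₄⟩ := exists_hasse_walk_of_le hxb'
  have hK : ∀ u ∈ (w₁.append w₂.reverse).support, (a ≤ u ∨ c ≤ u) ∧ u ≤ b := by
    intro u hu
    rw [SimpleGraph.Walk.mem_support_append_iff, SimpleGraph.Walk.support_reverse,
      List.mem_reverse] at hu
    exact hu.elim (fun h => ⟨Or.inl (hw₁ u h).1, (hw₁ u h).2⟩)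
      fun h => ⟨Or.inr (hw₂ u h).1, (hw₂ u h).2⟩
  have hL : ∀ u ∈ (w₃.append w₄.reverse).support, u ≤ b' := by
    intro u hu
    rw [SimpleGraph.Walk.mem_support_append_iff, SimpleGraph.Walk.support_reverse,
      List.mem_reverse] at hu
    exact hu.elim (fun h => (hw₃ u h).2) fun h => (hw₄ u h).2
  obtain ⟨p, q, r, hp, hq, hr, hpS, hqS, hrS, ⟨u, hu, huq⟩ | ⟨u, hu, h⟩⟩ :=
    D.exists_mem_support_of_between hS.isTree.isAcyclic ham hmc (w₁.append w₂.reverse)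
      (w₃.append w₄.reverse)
  · exact absurd ((hS.le_of_mem_support hm hq hqS huq).trans (hK u hu).2) hmb
  · rcases h with h | h | h
    · exact Or.inl ((hS.le_of_mem_support ha hp hpS h).trans (hL u hu))
    · exact Or.inr ((hS.le_of_mem_support hc hr hrS h).trans (hL u hu))
    · exact (hK u h).1.imp (fun h => h.trans (hL u hu)) fun h => h.trans (hL u hu)

theorem isAlternatingCycle_pair_iff {p q : P × P} : IsAlternatingCycle ![p, q] ↔
    (IncompRel (· ≤ ·) p.1 p.2 ∧ IncompRel (· ≤ ·) q.1 q.2) ∧ p.1 ≤ q.2 ∧ q.1 ≤ p.2 := by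
  simp [IsAlternatingCycle, Fin.forall_fin_two]

/-- The digraph `H_I` is transitive. -/
theorem auxDigraph_adj_trans [Finite P] {I : Set (P × P)} {x₀ y₀ : P}
    (hI : DoublyConstrainedBy I x₀ y₀) (D : ExteriorDrawing (SimpleGraph.hasse P) x₀ y₀)
    {S : (SimpleGraph.hasse P).Subgraph} (hS : IsRedTree S y₀ (firstSet I))
    {p q r : Inc (firstSet I) (secondSet I)} (hpq : (auxDigraph I D S).Adj p q)
    (hqr : (auxDigraph I D S).Adj q r) : (auxDigraph I D S).Adj p r := by
  obtain ⟨h1, h2⟩ := hpq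
  obtain ⟨h3, h4⟩ := hqr
  rw [isAlternatingCycle_pair_iff] at h1 h3
  obtain ⟨⟨hp, hq⟩, hpq, hqp⟩ := h1
  obtain ⟨⟨-, hr⟩, hqr, hrq⟩ := h3
  have hx : ∀ s : Inc (firstSet I) (secondSet I), x₀ ≤ s.1.2 := fun s => by
    obtain ⟨a, ha⟩ := s.2.2.1
    exact (hI.lt_snd _ ha).le
  have key : ∀ b', q.1.1 ≤ b' → x₀ ≤ b' → p.1.1 ≤ b' ∨ r.1.1 ≤ b' := fun b' hb' hxb' =>
    le_or_le_of_clockwise D hS p.2.1 q.2.1 r.2.1 h2 h4 hpq hrq hq.1 hb' hxb'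
  refine ⟨isAlternatingCycle_pair_iff.2 ⟨⟨hp, hr⟩, ?_, ?_⟩, h2.trans hS.isTree.isAcyclic h4⟩
  · exact (key r.1.2 hqr (hx r)).resolve_right hr.1
  · exact (key p.1.2 hqp (hx p)).resolve_left hp.1

/-- Incomparable pairs of minimal and maximal elements, any two of which form an alternating
cycle, induce a standard example. -/
theorem exists_standardExample_embedding {n : ℕ} (p : Fin n → P × P)
    (hmin : ∀ i, IsMin (p i).1) (hmax : ∀ i, IsMax (p i).2)
    (hnmax : ∀ i, ¬ IsMax (p i).1) (hle : ∀ i j, (p i).1 ≤ (p j).2 ↔ i ≠ j) :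
    ∃ f : StandardExample n ↪o P, ∀ i, f (.a i) = (p i).1 ∧ f (.b i) = (p i).2 := by
  let g : StandardExample n → P
    | .a i => (p i).1
    | .b i => (p i).2
  have haa : ∀ i j, (p i).1 ≤ (p j).1 → i = j := fun i j h => by
    have h1 : (p j).1 ≤ (p i).1 := hmin j h
    by_contra hij
    exact (hle j j).1 (h1.trans ((hle i j).2 hij)) rfl
  have hbb : ∀ i j, (p i).2 ≤ (p j).2 → i = j := fun i j h => by
    have h1 : (p j).2 ≤ (p i).2 := hmax i h
    by_contra hij
    exact (hle i i).1 (((hle i j).2 hij).trans h1) rfl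
  have hba : ∀ i j, ¬ (p i).2 ≤ (p j).1 := fun i j h => by
    have h1 : (p j).1 = (p i).2 := le_antisymm (hmax i h) h
    exact hnmax j (h1 ▸ hmax i)
  refine ⟨OrderEmbedding.ofMapLEIff g ?_, fun i => ⟨rfl, rfl⟩⟩
  intro x y
  constructor
  · intro h
    cases x with
    | a i => cases y with
      | a j => exact Or.inl (congrArg _ (haa i j h))
      | b j => exact Or.inr ⟨i, j, (hle i j).1 h, rfl, rfl⟩
    | b i => cases y with
      | a j => exact absurd h (hba i j)
      | b j => exact Or.inl (congrArg _ (hbb i j h))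
  · rintro (rfl | ⟨i, j, hij, rfl, rfl⟩)
    · exact le_rfl
    · exact (hle i j).2 hij
end

theorem proposition3p6 {P : Type*} [PartialOrder P] [Finite P]
    (I : Set (P × P)) (x₀ y₀ : P) (hI : DoublyExposedBy I x₀ y₀)
    (D : ExteriorDrawing (SimpleGraph.hasse P) x₀ y₀)
    (S : (SimpleGraph.hasse P).Subgraph) (hS : IsRedTree S y₀ (firstSet I))
    (n : ℕ) (hn : 2 ≤ n) (p : Fin n → Inc (firstSet I) (secondSet I))
    (hp : IsDirectedPath (auxDigraph I D S) p) :
    (∀ i j : Fin n, i < j → (auxDigraph I D S).Adj (p i) (p j)) ∧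
    ∃ f : StandardExample n ↪o P,
      ∀ i, f (.a i) = (p i).1.1 ∧ f (.b i) = (p i).1.2 := by
  have hadj : ∀ i j : Fin n, i < j → (auxDigraph I D S).Adj (p i) (p j) := by
    have key : ∀ (k : ℕ) (i j : Fin n), (i : ℕ) + k + 1 = j →
        (auxDigraph I D S).Adj (p i) (p j) := by
      intro k
      induction k with
      | zero => exact fun i j h => hp.2 i j h
      | succ k ih =>
        intro i j h
        have hk : (i : ℕ) + k + 1 < n := by omega
        exact auxDigraph_adj_trans hI.1 D hS (ih i ⟨_, hk⟩ rfl) (hp.2 ⟨_, hk⟩ j h)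
    exact fun i j hij => key (j - i - 1) i j (by omega)
  refine ⟨hadj, exists_standardExample_embedding (fun i => (p i).1) ?_ ?_ ?_ ?_⟩
  · intro i
    obtain ⟨b, hb⟩ := (p i).2.1
    exact (hI.1.subset hb).1
  · intro i
    obtain ⟨a, ha⟩ := (p i).2.2.1
    exact (hI.1.subset ha).2.1
  · intro i h
    obtain ⟨b, hb⟩ := (p i).2.1
    exact h.not_lt (hI.1.fst_lt (_, b) hb)
  · refine fun i j => ⟨?_, fun hij => ?_⟩
    · rintro h rfl
      exact (p i).2.2.2.1 h
    · rcases lt_or_gt_of_ne hij with h | h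
      · exact (isAlternatingCycle_pair_iff.1 (hadj i j h).1).2.1
      · exact (isAlternatingCycle_pair_iff.1 (hadj j i h).1).2.2
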